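/- Let $T>0$, $k\in\mathbb{N}$, and let $(\Omega,\mathscr F,\mathbb P_0)$ be a probability space carrying $\mathbb{Z}_{\ge 0}$-valued random variables $N_t(i)$, $1\le i\le k$, $t\in[0,T]$; put $N_t=(N_t(1),\dots,N_t(k))$ and $\mathscr F^N_t=\sigma(N_s:0\le s\le t)$. Let $\beta_i,\nu_i:[0,T]\to\mathbb{R}$ be continuous functions with values in $[\beta_{\min},\beta_{\max}]$ and $[\nu_{\min},\nu_{\max}]$ respectively, where the constants $0<\beta_{\min}<\beta_{\max}<\infty$ and $0<\nu_{\min}<\nu_{\max}<\infty$ do not depend on $i$. For a probability measure $\mathbb P$ on $(\Omega,\mathscr F)$ and a nonnegative, measurable, integrable $\lambda:[0,T]\to\mathbb{R}$, the process $N_t(i)$ is called an $\mathscr F^N_t$-Poisson process over $[0,T]$ with intensity $\lambda$ under $\mathbb P$ if it is a counting process (each path starts at $0$, is non-decreasing, right-continuous and piecewise constant, and increases in steps of size $1$) and, for all $0\le s\le t\le T$, the increment $N_t(i)-N_s(i)$ is independent of $\mathscr F^N_s$ under $\mathbb P$ and is Poisson distributed with parameter $\int_s^t\lambda(u)\,du$.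 Suppose that under $\mathbb P_0$ the processes $(N_t(i))_{t\in[0,T]}$, $1\le i\le k$, are mutually independent $\mathscr F^N_t$-Poisson processes over $[0,T]$ with intensities $\beta_i$. Let $\tau_n(i)$ denote the $n$-th jump time of $N_t(i)$, and let $$L_T=\prod_{i=1}^k L_T(i),\qquad L_T(i)=\exp\Big(-\int_0^T\nu_i(s)\,ds\Big)\prod_{n=1}^{N_T(i)}\Big(1+\frac{\nu_i(\tau_n(i))}{\beta_i(\tau_n(i))}\Big).$$ Then $L_T$ is a random variable, and $\mathbb P_1(A)=\int_A L_T\,d\mathbb P_0$, $A\in\mathscr F$, defines a probability measure $\mathbb P_1$ on $(\Omega,\mathscr F)$ with $\mathbb P_1\ll\mathbb P_0$, under which the processes $(N_t(i))_{t\in[0,T]}$, $1\le i\le k$, are mutually independent $\mathscr F^N_t$-Poisson processes over $[0,T]$ with intensities $\beta_i+\nu_i$. -/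

import Mathlib

open MeasureTheory ProbabilityTheory

namespace PoissonDetection

/-- The path `x` is the path of a counting process over the time horizon `[0, T]`: it starts at `0`,
is non-decreasing, right-continuous (hence, being `ℕ`-valued, piecewise constant), and increases in
steps of size `1`. Values of `x` outside `[0, T]` play no role. -/
structure IsCountingPath (T : ℝ) (x : ℝ → ℕ) : Prop where
  zero : x 0 = 0
  mono : MonotoneOn x (Set.Icc 0 T)
  rightCont : ∀ t ∈ Set.Icc 0 T, ContinuousWithinAt x (Set.Icc t T) t
  -- For times `s < t` close to `t`, `x s` is the left limit of `x` at `t`.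
  unitJump : ∀ t ∈ Set.Ioc 0 T, ∀ᶠ s in nhdsWithin t (Set.Iio t), x t ≤ x s + 1

/-- The `n`-th jump time `τ_n` (`n ≥ 1`) of the counting path `x` over `[0, T]`, i.e. the first time
at which `n` counts have been registered. Only meaningful (and only used) for `n ≤ x T`. -/
noncomputable def jumpTime (T : ℝ) (x : ℝ → ℕ) (n : ℕ) : ℝ :=
  sInf {t | t ∈ Set.Icc 0 T ∧ n ≤ x t}

/-- The filtration `ℱ^N_t = σ(N_s : 0 ≤ s ≤ t)`, `t ∈ [0, T]`, generated by the vector of processes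
`N_t = (N_t(1), …, N_t(k))`. -/
noncomputable def history {Ω : Type*} [mΩ : MeasurableSpace Ω] {k : ℕ} {T : ℝ}
    (N : Fin k → ℝ → Ω → ℕ) (hN : ∀ i, ∀ t : Set.Icc (0 : ℝ) T, Measurable (N i t)) :
    Filtration (Set.Icc (0 : ℝ) T) mΩ :=
  Filtration.natural (fun (t : Set.Icc (0 : ℝ) T) ω (i : Fin k) => N i t ω)
    (fun t => (measurable_pi_lambda _ (fun i => hN i t)).stronglyMeasurable)

/-- `N` is a `(P, ℱ_t)`-Poisson process over `[0, T]` with (deterministic, time-dependent)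
intensity `r`. The truncated difference `N t ω - N s ω` is the true one since paths are
non-decreasing. -/
structure IsPoissonProcess {Ω : Type*} [mΩ : MeasurableSpace Ω] {T : ℝ} (P : Measure Ω)
    (ℱ : Filtration (Set.Icc (0 : ℝ) T) mΩ) (N : ℝ → Ω → ℕ) (r : ℝ → ℝ) : Prop where
  intensity_nonneg : ∀ t ∈ Set.Icc 0 T, 0 ≤ r t
  intensity_measurable : Measurable (fun t : Set.Icc (0 : ℝ) T => r t)
  intensity_integrable : IntegrableOn r (Set.Icc 0 T)
  counting : ∀ ω, IsCountingPath T (fun t => N t ω)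
  adapted : ∀ t : Set.Icc (0 : ℝ) T, Measurable[ℱ t] (N t)
  indep : ∀ s t : Set.Icc (0 : ℝ) T, s ≤ t →
    Indep (MeasurableSpace.comap (fun ω => N t ω - N s ω) ⊤) (ℱ s) P
  law : ∀ s t : Set.Icc (0 : ℝ) T, s ≤ t →
    HasLaw (fun ω => N t ω - N s ω) (poissonMeasure (∫ u in (s : ℝ)..t, r u).toNNReal) P

/-- Under `P`, the components `N_t(i)`, `t ∈ [0, T]`, are (mutually) independent processes and each
of them is an `ℱ^N_t`-Poisson process, with intensity `r i`. -/
structure AreIndepPoisson {Ω : Type*} [MeasurableSpace Ω] {k : ℕ} {T : ℝ} (P : Measure Ω)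
    (N : Fin k → ℝ → Ω → ℕ) (hN : ∀ i, ∀ t : Set.Icc (0 : ℝ) T, Measurable (N i t))
    (r : Fin k → ℝ → ℝ) : Prop where
  poisson : ∀ i, IsPoissonProcess P (history N hN) (N i) (r i)
  indep : iIndepFun (fun i ω (t : Set.Icc (0 : ℝ) T) => N i t ω) P

/-- The functions `f i` are continuous on `[0, T]` with values in a common interval `[m, M]`,
`0 < m < M < ∞`. -/
def IsAdmissible {k : ℕ} (T : ℝ) (f : Fin k → ℝ → ℝ) : Prop :=
  ∃ m M : ℝ, 0 < m ∧ m < M ∧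
    ∀ i, ContinuousOn (f i) (Set.Icc 0 T) ∧ Set.MapsTo (f i) (Set.Icc 0 T) (Set.Icc m M)

/-- `L_T(i) = exp(-∫_0^T ν_i(s) ds) ∏_{n=1}^{N_T(i)} (1 + ν_i(τ_n(i)) / β_i(τ_n(i)))`, computed from
the path `x = N_·(i)`. -/
noncomputable def localRatio (T : ℝ) (x : ℝ → ℕ) (b v : ℝ → ℝ) : ℝ :=
  Real.exp (-∫ s in (0 : ℝ)..T, v s) *
    ∏ n ∈ Finset.Icc 1 (x T), (1 + v (jumpTime T x n) / b (jumpTime T x n))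

/-- The likelihood ratio `L_T = ∏_{i=1}^k L_T(i)`. -/
noncomputable def likelihoodRatio {Ω : Type*} {k : ℕ} (T : ℝ) (N : Fin k → ℝ → Ω → ℕ)
    (β ν : Fin k → ℝ → ℝ) (ω : Ω) : ℝ :=
  ∏ i, localRatio T (fun t => N i t ω) (β i) (ν i)

/-- The measure `P₁` with `dP₁/dP₀ = L_T`, i.e. `P₁(A) = ∫_A L_T dP₀`. -/
noncomputable def tilted {Ω : Type*} [MeasurableSpace Ω] {k : ℕ} (P₀ : Measure Ω) (T : ℝ)
    (N : Fin k → ℝ → Ω → ℕ) (β ν : Fin k → ℝ → ℝ) : Measure Ω :=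
  P₀.withDensity (fun ω => ENNReal.ofReal (likelihoodRatio T N β ν ω))

end PoissonDetection

/-! For constant intensities the claim is exponential tilting: weighting Poisson(r) by `exp(-q) (1 +
q/r)^n` gives exactly Poisson(r + q). For varying intensities, cut `(s, t]` into small cells and
tilt each cell's increment with `q = ∫ v` and `r = ∫ b` over that cell. Increments are independent
of the past, so for every partition the resulting weight makes the total increment exactly Poisson
with parameter `∫ (b + v)` and independent of the past (`IsPoissonProcess.lintegral_gridRatio`).

The true density has a factor `1 + v/b` at each jump time. By uniform continuity of `v/b`, on a fine
partition it agrees with the cell factor up to `1 + δ`, uniformly over paths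
(`eventually_gridRatio_le`). On the event that the increment equals `n` the total error is at most
`(1 + δ)^n`, which tends to 1; hence the true density gives the same law, with no domination
argument (`IsPoissonProcess.lintegral_segmentRatio_eq`). The density is multiplicative over adjacent
time intervals, which carries this over to the whole horizon
(`IsPoissonProcess.lintegral_localRatio`).

The components are independent and each density factor depends on one path only, so the product
density preserves their independence (`iIndep_withDensity_prod`). The joint past lies in the
σ-algebra generated by a component's own past and the other whole paths, which upgrades independence
from the own past to independence from the joint past (`indep_sup_right`, `history_le_sup`). -/

namespace PoissonDetection

open Filter Topology
open scoped ENNReal NNReal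

/-! ### Tilting of Poisson laws and of increments over a partition. -/

section

/-- Fubini for a discrete random variable `D` independent of the σ-algebra `m`. -/
lemma lintegral_comp_of_indep {Ω : Type*} {m mΩ : MeasurableSpace Ω} {P : Measure Ω}
    (hm : m ≤ mΩ) {D : Ω → ℕ} (hD : Measurable D)
    (hind : Indep (MeasurableSpace.comap D ⊤) m P) {F : Ω → ℕ → ℝ≥0∞}
    (hF : ∀ n, Measurable[m] fun ω => F ω n) :
    ∫⁻ ω, F ω (D ω) ∂P = ∫⁻ n, ∫⁻ ω, F ω n ∂P ∂(P.map D) := by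
  have hset : ∀ n, MeasurableSet[MeasurableSpace.comap D ⊤] (D ⁻¹' {n}) := fun n =>
    ⟨{n}, trivial, rfl⟩
  have hsplit : ∀ ω, F ω (D ω) = ∑' n, (D ⁻¹' {n}).indicator (fun _ => 1) ω * F ω n := by
    intro ω
    rw [tsum_eq_single (D ω)]
    · simp
    · intro n hn
      simp [Set.indicator, hn.symm]
  have hDle : MeasurableSpace.comap D ⊤ ≤ mΩ := measurable_iff_comap_le.1 hD
  simp_rw [hsplit]
  rw [lintegral_tsum, lintegral_countable']
  · refine tsum_congr fun n => ?_
    rw [lintegral_mul_eq_lintegral_mul_lintegral_of_independent_measurableSpace hDle hm hind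
      (measurable_const.indicator (hset n)) (hF n),
      lintegral_indicator_const (hDle _ (hset n)), one_mul, mul_comm,
      Measure.map_apply hD (measurableSet_singleton n)]
  · intro n
    exact ((measurable_const.indicator (hDle _ (hset n))).mul
      ((hF n).mono hm le_rfl)).aemeasurable

/-- Exponential tilting of a Poisson law. -/
lemma poissonMeasure_withDensity {r q : ℝ≥0} (h : r = 0 → q = 0) :
    (poissonMeasure r).withDensity
      (fun n => ENNReal.ofReal (Real.exp (-q) * (1 + (q : ℝ) / r) ^ n)) =
      poissonMeasure (r + q) := by
  refine Measure.ext_of_singleton fun n => ?_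
  rw [withDensity_apply _ (measurableSet_singleton n), lintegral_singleton,
    poissonMeasure_singleton, poissonMeasure_singleton, ← ENNReal.ofReal_mul (by positivity)]
  congr 1
  have hr : (1 + (q : ℝ) / r) * r = r + q := by
    -- For `r = 0` the quotient `q / r` is 0 by convention; the identity survives because `q = 0`
    -- too. Degenerate cells need this case.
    rcases eq_or_ne r 0 with h0 | h0
    · simp [h0, h h0]
    · have : (r : ℝ) ≠ 0 := by exact_mod_cast h0
      field_simp
  have he : Real.exp (-((r + q : ℝ≥0) : ℝ)) = Real.exp (-q) * Real.exp (-r) := by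
    rw [← Real.exp_add]; congr 1; push_cast; ring
  rw [he]
  push_cast
  rw [← hr, mul_pow]
  ring

variable {Ω : Type*} [mΩ : MeasurableSpace Ω] {T : ℝ} {P : Measure Ω}
  {ℱ : Filtration (Set.Icc (0 : ℝ) T) mΩ} {N : ℝ → Ω → ℕ} {b : ℝ → ℝ}

lemma IsPoissonProcess.measurable (hP : IsPoissonProcess P ℱ N b) (t : Set.Icc (0 : ℝ) T) :
    Measurable (N t) := (hP.adapted t).mono (ℱ.le t) le_rfl

lemma IsPoissonProcess.measurable_sub (hP : IsPoissonProcess P ℱ N b)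
    {s t u : Set.Icc (0 : ℝ) T} (hs : s ≤ u) (ht : t ≤ u) :
    Measurable[ℱ u] fun ω => N t ω - N s ω :=
  Measurable.sub ((hP.adapted t).mono (ℱ.mono ht) le_rfl)
    ((hP.adapted s).mono (ℱ.mono hs) le_rfl)

/-- Reweighting the increments of a Poisson process over a partition changes the law of the total
increment and keeps it independent of the past. -/
lemma IsPoissonProcess.lintegral_prod_increments (hP : IsPoissonProcess P ℱ N b)
    {u : ℕ → Set.Icc (0 : ℝ) T} (hu : Monotone u) {h : ℕ → ℕ → ℝ≥0∞} {ρ : ℕ → ℝ≥0}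
    (hρ : ∀ j, (poissonMeasure (∫ x in (u j : ℝ)..u (j + 1), b x).toNNReal).withDensity (h j) =
      poissonMeasure (ρ j))
    {X : Ω → ℝ≥0∞} (hX : Measurable[ℱ (u 0)] X) (m : ℕ) (g : ℕ → ℝ≥0∞) :
    ∫⁻ ω, X ω * (∏ j ∈ Finset.range m, h j (N (u (j + 1)) ω - N (u j) ω)) *
        g (N (u m) ω - N (u 0) ω) ∂P =
      (∫⁻ ω, X ω ∂P) * ∫⁻ n, g n ∂poissonMeasure (∑ j ∈ Finset.range m, ρ j) := by
  -- The test function must vary: splitting off the last increment, equal to `n`, replaces `g` by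
  -- its shift by `n`.
  induction m generalizing g with
  | zero =>
    have h0 : poissonMeasure 0 = Measure.dirac 0 := by
      refine Measure.ext_of_singleton fun n => ?_
      rw [poissonMeasure_singleton]
      rcases Nat.eq_zero_or_pos n with rfl | hn
      · simp
      · simp [hn.ne', hn.ne]
    simp [h0, lintegral_mul_const _ (hX.mono (ℱ.le _) le_rfl)]
  | succ m ih =>
    have hmono : ∀ (s t : Set.Icc (0 : ℝ) T) ω, s ≤ t → N s ω ≤ N t ω := fun s t ω hst =>
      (hP.counting ω).mono s.2 t.2 hst
    have hsum : ∀ ω, N (u (m + 1)) ω - N (u 0) ω =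
        (N (u m) ω - N (u 0) ω) + (N (u (m + 1)) ω - N (u m) ω) := fun ω => by
      have h1 := hmono _ _ ω (hu (Nat.zero_le m))
      have h2 := hmono _ _ ω (hu (Nat.le_succ m))
      simp only [Nat.succ_eq_add_one] at h2
      omega
    have hle := hu (Nat.le_succ m)
    -- Only the last increment is not known at time `u m`, and it is independent of that past, so it
    -- can be integrated separately.
    have key := lintegral_comp_of_indep (P := P) (ℱ.le (u m))
      ((hP.measurable_sub hle le_rfl).mono (ℱ.le _) le_rfl) (hP.indep _ _ hle)
      (F := fun ω n => X ω * (∏ j ∈ Finset.range m, h j (N (u (j + 1)) ω - N (u j) ω)) * h m n *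
        g (N (u m) ω - N (u 0) ω + n)) (fun n => by
          have hXm := hX.mono (ℱ.mono (hu (Nat.zero_le m))) le_rfl
          have hprod : Measurable[ℱ (u m)] fun ω =>
              ∏ j ∈ Finset.range m, h j (N (u (j + 1)) ω - N (u j) ω) := by
            refine Finset.measurable_fun_prod _ fun j hj => ?_
            exact (measurable_from_top (f := h j)).comp
              (hP.measurable_sub (hu (Finset.mem_range.1 hj).le) (hu (Finset.mem_range.1 hj)))
          have hg : Measurable[ℱ (u m)] fun ω => g (N (u m) ω - N (u 0) ω + n) :=
            (measurable_from_top (f := fun l => g (l + n))).comp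
              (hP.measurable_sub (hu (Nat.zero_le m)) le_rfl)
          exact ((hXm.mul hprod).mul measurable_const).mul hg)
    rw [(hP.law _ _ hle).map_eq] at key
    calc _ = _ := by
          simp_rw [Finset.prod_range_succ, hsum]
          refine Eq.trans (lintegral_congr fun ω => ?_) key
          simp only [Nat.succ_eq_add_one]
          ring
      _ = ∫⁻ n, h m n * ((∫⁻ ω, X ω ∂P) *
            ∫⁻ l, g (l + n) ∂poissonMeasure (∑ j ∈ Finset.range m, ρ j))
            ∂poissonMeasure (∫ x in (u m : ℝ)..u (m + 1), b x).toNNReal := by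
          refine lintegral_congr fun n => ?_
          rw [← ih (fun l => g (l + n)), ← lintegral_const_mul]
          · refine lintegral_congr fun ω => ?_
            ring
          · refine ((hX.mono (ℱ.le _) le_rfl).mul (Finset.measurable_fun_prod _ fun j _ => ?_)).mul
              ?_
            · exact (measurable_from_top (f := h j)).comp
                ((hP.measurable _).sub (hP.measurable _))
            · exact (measurable_from_top (f := fun l => g (l + n))).comp
                ((hP.measurable _).sub (hP.measurable _))
      _ = ∫⁻ n, ((∫⁻ ω, X ω ∂P) *
            ∫⁻ l, g (l + n) ∂poissonMeasure (∑ j ∈ Finset.range m, ρ j)) ∂poissonMeasure (ρ m) := by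
          rw [← hρ m, lintegral_withDensity_eq_lintegral_mul _ measurable_from_top
            measurable_from_top]
          rfl
      _ = _ := by
          -- Convolution of Poisson laws adds the parameters.
          rw [lintegral_const_mul _ measurable_from_top, Finset.sum_range_succ,
            add_comm _ (ρ m), ← poissonMeasure_conv_poissonMeasure,
            Measure.lintegral_conv measurable_from_top]
          simp_rw [add_comm]

end

/-! ### Pathwise comparison of the density with its discretisation. -/

section

lemma prod_range_prod_Ioc {M : Type*} [CommMonoid M] {a : ℕ → ℕ} (ha : Monotone a) (F : ℕ → M)
    (m : ℕ) :
    ∏ j ∈ Finset.range m, ∏ n ∈ Finset.Ioc (a j) (a (j + 1)), F n =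
      ∏ n ∈ Finset.Ioc (a 0) (a m), F n := by
  induction m with
  | zero => simp
  | succ m ih =>
    rw [Finset.prod_range_succ, ih,
      Finset.prod_Ioc_consecutive _ (ha (Nat.zero_le m)) (ha (Nat.le_succ m))]

/-- Each count costs one factor `q`, so the total error depends on the path only through its
increment. -/
lemma prod_range_prod_Ioc_le {a : ℕ → ℕ} (ha : Monotone a) {G H : ℕ → ℕ → ℝ} {q : ℝ} (m : ℕ)
    (hG : ∀ j, ∀ n ∈ Finset.Ioc (a j) (a (j + 1)), 0 ≤ G j n)
    (hGH : ∀ j < m, ∀ n ∈ Finset.Ioc (a j) (a (j + 1)), G j n ≤ q * H j n) :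
    ∏ j ∈ Finset.range m, ∏ n ∈ Finset.Ioc (a j) (a (j + 1)), G j n ≤
      q ^ (a m - a 0) * ∏ j ∈ Finset.range m, ∏ n ∈ Finset.Ioc (a j) (a (j + 1)), H j n := by
  have hq : q ^ (a m - a 0) =
      ∏ j ∈ Finset.range m, ∏ n ∈ Finset.Ioc (a j) (a (j + 1)), q := by
    rw [prod_range_prod_Ioc ha]; simp
  rw [hq, ← Finset.prod_mul_distrib]
  refine Finset.prod_le_prod (fun j _ => Finset.prod_nonneg (hG j)) fun j hj => ?_
  rw [← Finset.prod_mul_distrib]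
  exact Finset.prod_le_prod (hG j) (hGH j (Finset.mem_range.1 hj))

/-- The quotient of two integrals is close to the quotient of the integrands. -/
lemma integral_div_integral_sub_le {b v : ℝ → ℝ} {p q y δ : ℝ} (hpq : p < q)
    (hb : ContinuousOn b (Set.Icc p q)) (hv : ContinuousOn v (Set.Icc p q))
    (hb0 : ∀ z ∈ Set.Icc p q, 0 < b z)
    (hosc : ∀ z ∈ Set.Icc p q, |v z / b z - v y / b y| ≤ δ) :
    |(∫ z in p..q, v z) / (∫ z in p..q, b z) - v y / b y| ≤ δ := by
  have hbi : IntervalIntegrable b volume p q :=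
    ContinuousOn.intervalIntegrable (by rwa [Set.uIcc_of_le hpq.le])
  have hvi : IntervalIntegrable v volume p q :=
    ContinuousOn.intervalIntegrable (by rwa [Set.uIcc_of_le hpq.le])
  have hpos : 0 < ∫ z in p..q, b z :=
    intervalIntegral.intervalIntegral_pos_of_pos_on hbi
      (fun z hz => hb0 z ⟨hz.1.le, hz.2.le⟩) hpq
  have hup : ∫ z in p..q, v z ≤ (v y / b y + δ) * ∫ z in p..q, b z := by
    rw [← intervalIntegral.integral_const_mul]
    refine intervalIntegral.integral_mono_on hpq.le hvi (hbi.const_mul _) fun z hz => ?_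
    have := (abs_le.1 (hosc z hz)).2
    rw [← div_le_iff₀ (hb0 z hz)]
    linarith
  have hlo : (v y / b y - δ) * ∫ z in p..q, b z ≤ ∫ z in p..q, v z := by
    rw [← intervalIntegral.integral_const_mul]
    refine intervalIntegral.integral_mono_on hpq.le (hbi.const_mul _) hvi fun z hz => ?_
    have := (abs_le.1 (hosc z hz)).1
    rw [← le_div_iff₀ (hb0 z hz)]
    linarith
  rw [← div_le_iff₀ hpos] at hup
  rw [← le_div_iff₀ hpos] at hlo
  rw [abs_le]
  constructor <;> linarith

variable {T : ℝ}

/-- Monotonicity alone gives this. Right-continuity would exclude the left endpoint, but the closed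
interval is enough for an oscillation bound. -/
lemma IsCountingPath.jumpTime_mem {x : ℝ → ℕ} (hx : IsCountingPath T x) {p q : ℝ}
    (hp : p ∈ Set.Icc 0 T) (hq : q ∈ Set.Icc 0 T) {n : ℕ} (hn : n ∈ Finset.Ioc (x p) (x q)) :
    jumpTime T x n ∈ Set.Icc p q := by
  rw [Finset.mem_Ioc] at hn
  have hmem : q ∈ {t | t ∈ Set.Icc 0 T ∧ n ≤ x t} := ⟨hq, hn.2⟩
  refine ⟨le_csInf ⟨q, hmem⟩ fun t ht => ?_, csInf_le ⟨0, fun t ht => ht.1.1⟩ hmem⟩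
  by_contra hlt
  have := hx.mono ht.1 hp (not_le.1 hlt).le
  have := ht.2
  omega

/-- The contribution of the time interval `(s, t]` to `localRatio`. -/
noncomputable def segmentRatio (T : ℝ) (x : ℝ → ℕ) (b v : ℝ → ℝ) (s t : ℝ) : ℝ :=
  Real.exp (-∫ z in s..t, v z) *
    ∏ n ∈ Finset.Ioc (x s) (x t), (1 + v (jumpTime T x n) / b (jumpTime T x n))

/-- The uniform partition of `[s, t]` into `m + 1` intervals, constant beyond its end. -/
noncomputable def grid (s t : Set.Icc (0 : ℝ) T) (hst : s ≤ t) (m j : ℕ) : Set.Icc (0 : ℝ) T :=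
  ⟨s + (t - s) * min ((j : ℝ) / (m + 1)) 1, by
    have hst' : (s : ℝ) ≤ t := hst
    have h0 : (0 : ℝ) ≤ min ((j : ℝ) / (m + 1)) 1 := by positivity
    have h1 : min ((j : ℝ) / (m + 1)) 1 ≤ 1 := min_le_right _ _
    have := s.2.1
    have := t.2.2
    constructor <;> nlinarith⟩

lemma grid_monotone (s t : Set.Icc (0 : ℝ) T) (hst : s ≤ t) (m : ℕ) :
    Monotone (grid s t hst m) := by
  intro i j hij
  have hst' : (0 : ℝ) ≤ t - s := sub_nonneg.2 hst
  rw [← Subtype.coe_le_coe]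
  simp only [grid]
  gcongr

@[simp] lemma grid_zero (s t : Set.Icc (0 : ℝ) T) (hst : s ≤ t) (m : ℕ) :
    grid s t hst m 0 = s := by
  simp [grid]

@[simp] lemma grid_last (s t : Set.Icc (0 : ℝ) T) (hst : s ≤ t) (m : ℕ) :
    grid s t hst m (m + 1) = t := by
  have : (m + 1 : ℝ) / (m + 1) = 1 := div_self (by positivity)
  simp [grid, this]

lemma grid_succ_sub_le (s t : Set.Icc (0 : ℝ) T) (hst : s ≤ t) (m j : ℕ) :
    (grid s t hst m (j + 1) : ℝ) - grid s t hst m j ≤ (t - s) / (m + 1) := by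
  have hst' : (0 : ℝ) ≤ t - s := sub_nonneg.2 hst
  have hmin : min (((j + 1 : ℕ) : ℝ) / (m + 1)) 1 ≤ min ((j : ℝ) / (m + 1)) 1 + 1 / (m + 1) := by
    have hm : (0 : ℝ) ≤ 1 / (m + 1) := by positivity
    rw [← min_add_add_right]
    refine le_min ((min_le_left _ _).trans ?_) ((min_le_right _ _).trans (by linarith))
    push_cast
    rw [add_div]
  simp only [grid]
  calc _ = (t - s : ℝ) * (min (((j + 1 : ℕ) : ℝ) / (m + 1)) 1 - min ((j : ℝ) / (m + 1)) 1) := by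
        ring
    _ ≤ (t - s : ℝ) * (1 / (m + 1)) := by gcongr; linarith
    _ = _ := by ring

/-- The weight of `n` counts in the `j`-th interval of the partition. -/
noncomputable def gridWeight (b v : ℝ → ℝ) (u : ℕ → Set.Icc (0 : ℝ) T) (j n : ℕ) : ℝ :=
  Real.exp (-∫ z in (u j : ℝ)..u (j + 1), v z) *
    (1 + (∫ z in (u j : ℝ)..u (j + 1), v z) / ∫ z in (u j : ℝ)..u (j + 1), b z) ^ n

/-- The approximation of `segmentRatio` that only uses the increments over the partition. -/
noncomputable def gridRatio (x : ℝ → ℕ) (b v : ℝ → ℝ) (u : ℕ → Set.Icc (0 : ℝ) T) (m : ℕ) : ℝ :=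
  ∏ j ∈ Finset.range m, gridWeight b v u j (x (u (j + 1)) - x (u j))

/-- The regularity of the intensities used throughout. -/
structure IsRegularPair (T : ℝ) (b v : ℝ → ℝ) : Prop where
  contLeft : ContinuousOn b (Set.Icc 0 T)
  contRight : ContinuousOn v (Set.Icc 0 T)
  posLeft : ∀ z ∈ Set.Icc 0 T, 0 < b z
  posRight : ∀ z ∈ Set.Icc 0 T, 0 < v z

variable {b v : ℝ → ℝ}

lemma intervalIntegrable_of_continuousOn {f : ℝ → ℝ} (hf : ContinuousOn f (Set.Icc 0 T))
    (s t : Set.Icc (0 : ℝ) T) : IntervalIntegrable f volume s t :=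
  (hf.mono (Set.uIcc_subset_Icc s.2 t.2)).intervalIntegrable

lemma integral_nonneg_of_pos {f : ℝ → ℝ} (hf : ∀ z ∈ Set.Icc 0 T, 0 < f z)
    {s t : Set.Icc (0 : ℝ) T} (hst : s ≤ t) : 0 ≤ ∫ z in (s : ℝ)..t, f z :=
  intervalIntegral.integral_nonneg hst fun z hz =>
    (hf z ⟨s.2.1.trans hz.1, hz.2.trans t.2.2⟩).le

lemma sum_integral_grid {f : ℝ → ℝ} (hf : ContinuousOn f (Set.Icc 0 T))
    (s t : Set.Icc (0 : ℝ) T) (hst : s ≤ t) (m : ℕ) :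
    ∑ j ∈ Finset.range (m + 1), ∫ z in (grid s t hst m j : ℝ)..grid s t hst m (j + 1), f z =
      ∫ z in (s : ℝ)..t, f z := by
  rw [intervalIntegral.sum_integral_adjacent_intervals
    (a := fun j => (grid s t hst m j : ℝ)) fun j _ => intervalIntegrable_of_continuousOn hf _ _]
  simp

lemma gridWeight_nonneg (h : IsRegularPair T b v) {u : ℕ → Set.Icc (0 : ℝ) T} (hu : Monotone u)
    (j n : ℕ) : 0 ≤ gridWeight b v u j n := by
  have h1 := integral_nonneg_of_pos h.posLeft (hu (Nat.le_succ j))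
  have h2 := integral_nonneg_of_pos h.posRight (hu (Nat.le_succ j))
  simp only [Nat.succ_eq_add_one] at h1 h2
  unfold gridWeight
  positivity

lemma segmentRatio_nonneg (h : IsRegularPair T b v) {x : ℝ → ℕ} (hx : IsCountingPath T x)
    (s t : Set.Icc (0 : ℝ) T) : 0 ≤ segmentRatio T x b v s t := by
  refine mul_nonneg (Real.exp_pos _).le (Finset.prod_nonneg fun n hn => ?_)
  have hmem := hx.jumpTime_mem s.2 t.2 hn
  have hmem' : jumpTime T x n ∈ Set.Icc 0 T := ⟨s.2.1.trans hmem.1, hmem.2.trans t.2.2⟩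
  have := h.posLeft _ hmem'
  have := h.posRight _ hmem'
  positivity

/-- Uniform comparison of `segmentRatio` and its approximation along fine partitions. -/
lemma eventually_gridRatio_le (h : IsRegularPair T b v) {s t : Set.Icc (0 : ℝ) T} (hst : s ≤ t)
    {δ : ℝ} (hδ : 0 < δ) :
    ∀ᶠ m : ℕ in atTop, ∀ x : ℝ → ℕ, IsCountingPath T x →
      gridRatio x b v (grid s t hst m) (m + 1) ≤
          (1 + δ) ^ (x t - x s) * segmentRatio T x b v s t ∧
        segmentRatio T x b v s t ≤
          (1 + δ) ^ (x t - x s) * gridRatio x b v (grid s t hst m) (m + 1) := by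
  have hφ : ContinuousOn (fun z => v z / b z) (Set.Icc 0 T) :=
    h.contRight.div h.contLeft fun z hz => (h.posLeft z hz).ne'
  obtain ⟨η, hη, hunif⟩ := Metric.uniformContinuousOn_iff.1
    (isCompact_Icc.uniformContinuousOn_of_continuous hφ) δ hδ
  have hmesh : Tendsto (fun m : ℕ => (t - s : ℝ) / (m + 1)) atTop (𝓝 0) :=
    Tendsto.div_atTop tendsto_const_nhds
      (tendsto_atTop_add_const_right _ _ tendsto_natCast_atTop_atTop)
  -- The mesh is fixed before the path `x`, which is what later allows integration over `ω` at fixed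
  -- `m`.
  filter_upwards [hmesh.eventually (gt_mem_nhds hη)] with m hm x hx
  set u := grid s t hst m with hu
  have humono : Monotone u := grid_monotone s t hst m
  have ha : Monotone fun j => x (u j) := fun i j hij => hx.mono (u i).2 (u j).2 (humono hij)
  set c : ℕ → ℝ := fun j =>
    1 + (∫ z in (u j : ℝ)..u (j + 1), v z) / ∫ z in (u j : ℝ)..u (j + 1), b z with hc
  set F : ℕ → ℝ := fun n => 1 + v (jumpTime T x n) / b (jumpTime T x n) with hF
  have hc1 : ∀ j, 1 ≤ c j := fun j => by
    have h1 := integral_nonneg_of_pos h.posLeft (humono (Nat.le_succ j))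
    have h2 := integral_nonneg_of_pos h.posRight (humono (Nat.le_succ j))
    exact le_add_of_nonneg_right (div_nonneg h2 h1)
  have hgrid : gridRatio x b v u (m + 1) = Real.exp (-∫ z in (s : ℝ)..t, v z) *
      ∏ j ∈ Finset.range (m + 1), ∏ _n ∈ Finset.Ioc (x (u j)) (x (u (j + 1))), c j := by
    simp only [gridRatio, gridWeight, Finset.prod_mul_distrib, Finset.prod_const, Nat.card_Ioc]
    rw [← Real.exp_sum, Finset.sum_neg_distrib, sum_integral_grid h.contRight]
  have hseg : segmentRatio T x b v s t = Real.exp (-∫ z in (s : ℝ)..t, v z) *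
      ∏ j ∈ Finset.range (m + 1), ∏ n ∈ Finset.Ioc (x (u j)) (x (u (j + 1))), F n := by
    rw [prod_range_prod_Ioc ha F (m + 1)]
    simp only [hu, grid_zero, grid_last]
    rfl
  have hmem : ∀ j, ∀ n ∈ Finset.Ioc (x (u j)) (x (u (j + 1))),
      1 ≤ F n ∧ |c j - F n| ≤ δ := by
    intro j n hn
    have hτ := hx.jumpTime_mem (u j).2 (u (j + 1)).2 hn
    have hsub : Set.Icc (u j : ℝ) (u (j + 1)) ⊆ Set.Icc 0 T :=
      Set.Icc_subset_Icc (u j).2.1 (u (j + 1)).2.2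
    -- A cell containing a jump has positive length, so `∫ b > 0` there.
    have hlt : (u j : ℝ) < u (j + 1) := by
      refine lt_of_le_of_ne (humono (Nat.le_succ j)) fun heq => ?_
      rw [heq] at hn
      simp at hn
    refine ⟨le_add_of_nonneg_right
      (div_pos (h.posRight _ (hsub hτ)) (h.posLeft _ (hsub hτ))).le, ?_⟩
    have := integral_div_integral_sub_le hlt (h.contLeft.mono hsub) (h.contRight.mono hsub)
      (fun z hz => h.posLeft z (hsub hz)) (δ := δ) fun z hz => by
        have hd := hunif z (hsub hz) _ (hsub hτ) (by
          have := grid_succ_sub_le s t hst m j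
          rw [Real.dist_eq, abs_lt]
          have h1 := hz.1; have h2 := hz.2; have h3 := hτ.1; have h4 := hτ.2
          constructor <;> linarith)
        exact (Real.dist_eq _ _ ▸ hd).le
    simpa [hc, hF] using this
  have hE := (Real.exp_pos (-∫ z in (s : ℝ)..t, v z)).le
  have hends : x (u (m + 1)) - x (u 0) = x t - x s := by simp [hu]
  -- Both `c j` and `F n` are at least 1, so the additive error `δ` is absorbed into the factor `1 +
  -- δ`, in either direction.
  have hup := prod_range_prod_Ioc_le ha (G := fun j _ => c j) (H := fun _ n => F n) (q := 1 + δ)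
    (m + 1) (fun j _ _ => zero_le_one.trans (hc1 j)) fun j _ n hn => by
      obtain ⟨h1, h2⟩ := hmem j n hn
      nlinarith [(abs_le.1 h2).2]
  have hlo := prod_range_prod_Ioc_le ha (G := fun _ n => F n) (H := fun j _ => c j) (q := 1 + δ)
    (m + 1) (fun j n hn => zero_le_one.trans (hmem j n hn).1) fun j _ n hn => by
      obtain ⟨h1, h2⟩ := hmem j n hn
      nlinarith [(abs_le.1 h2).1, hc1 j]
  rw [hends] at hup hlo
  rw [hgrid, hseg]
  constructor
  · calc _ ≤ _ := mul_le_mul_of_nonneg_left hup hE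
      _ = _ := by ring
  · calc _ ≤ _ := mul_le_mul_of_nonneg_left hlo hE
      _ = _ := by ring

/-- Needed for measurability only; the integrals are compared through the uniform bounds. -/
lemma tendsto_gridRatio (h : IsRegularPair T b v) {s t : Set.Icc (0 : ℝ) T} (hst : s ≤ t)
    {x : ℝ → ℕ} (hx : IsCountingPath T x) :
    Tendsto (fun m => gridRatio x b v (grid s t hst m) (m + 1)) atTop
      (𝓝 (segmentRatio T x b v s t)) := by
  set L := segmentRatio T x b v s t with hL
  set K := x t - x s
  have hpow : Tendsto (fun δ : ℝ => (1 + δ) ^ K) (𝓝[>] 0) (𝓝 1) := by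
    have : ContinuousAt (fun δ : ℝ => (1 + δ) ^ K) 0 := by fun_prop
    simpa [ContinuousAt] using this.tendsto.mono_left nhdsWithin_le_nhds
  rw [tendsto_order]
  constructor
  · intro a haL
    have : Tendsto (fun δ : ℝ => (1 + δ) ^ K * a) (𝓝[>] 0) (𝓝 a) := by
      simpa using hpow.mul_const a
    obtain ⟨δ, hδa, hδ⟩ := ((this.eventually (gt_mem_nhds haL)).and self_mem_nhdsWithin).exists
    filter_upwards [eventually_gridRatio_le h hst hδ] with m hm
    have hδ' : (0 : ℝ) < δ := hδ
    have := (hm x hx).2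
    exact lt_of_mul_lt_mul_left (hδa.trans_le this) (by positivity)
  · intro a haL
    have : Tendsto (fun δ : ℝ => (1 + δ) ^ K * L) (𝓝[>] 0) (𝓝 L) := by
      simpa using hpow.mul_const L
    obtain ⟨δ, hδa, hδ⟩ := ((this.eventually (gt_mem_nhds haL)).and self_mem_nhdsWithin).exists
    filter_upwards [eventually_gridRatio_le h hst hδ] with m hm
    exact (hm x hx).1.trans_lt hδa

lemma segmentRatio_mul (h : ContinuousOn v (Set.Icc 0 T)) {x : ℝ → ℕ} (hx : IsCountingPath T x)
    {r s t : Set.Icc (0 : ℝ) T} (hrs : r ≤ s) (hst : s ≤ t) :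
    segmentRatio T x b v r s * segmentRatio T x b v s t = segmentRatio T x b v r t := by
  simp only [segmentRatio]
  rw [← intervalIntegral.integral_add_adjacent_intervals
    (intervalIntegrable_of_continuousOn h r s) (intervalIntegrable_of_continuousOn h s t),
    neg_add, Real.exp_add,
    ← Finset.prod_Ioc_consecutive _ (hx.mono r.2 s.2 hrs) (hx.mono s.2 t.2 hst)]
  ring

lemma segmentRatio_zero_eq_localRatio {x : ℝ → ℕ} (hx : IsCountingPath T x) :
    segmentRatio T x b v 0 T = localRatio T x b v := by
  rw [segmentRatio, localRatio, hx.zero]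
  rfl

end

/-! ### Law of the increments under the reweighting of one component. -/

section

variable {Ω : Type*} [mΩ : MeasurableSpace Ω] {T : ℝ} {P : Measure Ω}
  {ℱ : Filtration (Set.Icc (0 : ℝ) T) mΩ} {N : ℝ → Ω → ℕ} {b v : ℝ → ℝ}

/-- As a pointwise limit of functions of finitely many increments, the ratio is measurable without
separate treatment of the jump times. -/
lemma IsPoissonProcess.measurable_segmentRatio (hP : IsPoissonProcess P ℱ N b)
    (h : IsRegularPair T b v) {s t : Set.Icc (0 : ℝ) T} (hst : s ≤ t) :
    Measurable[ℱ t] fun ω => segmentRatio T (fun z => N z ω) b v s t := by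
  refine @measurable_of_tendsto_metrizable Ω ℝ (ℱ t) _ _ _ _
    (fun m ω => gridRatio (fun z => N z ω) b v (grid s t hst m) (m + 1)) _ (fun m => ?_)
    (tendsto_pi_nhds.2 fun ω => tendsto_gridRatio h hst (hP.counting ω))
  refine Finset.measurable_fun_prod _ fun j hj => ?_
  have hle : ∀ i ≤ m + 1, grid s t hst m i ≤ t := fun i hi => by
    simpa using grid_monotone s t hst m hi
  exact (measurable_from_top (f := gridWeight b v (grid s t hst m) j)).comp
    (hP.measurable_sub (hle _ (Finset.mem_range.1 hj).le) (hle _ (Finset.mem_range.1 hj)))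

lemma IsPoissonProcess.lintegral_gridRatio (hP : IsPoissonProcess P ℱ N b)
    (h : IsRegularPair T b v) {s t : Set.Icc (0 : ℝ) T} (hst : s ≤ t)
    {X : Ω → ℝ≥0∞} (hX : Measurable[ℱ s] X) (m : ℕ) (g : ℕ → ℝ≥0∞) :
    ∫⁻ ω, X ω * ENNReal.ofReal (gridRatio (fun z => N z ω) b v (grid s t hst m) (m + 1)) *
        g (N t ω - N s ω) ∂P =
      (∫⁻ ω, X ω ∂P) * ∫⁻ n, g n ∂poissonMeasure (∫ z in (s : ℝ)..t, (b z + v z)).toNNReal := by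
  set u := grid s t hst m with hu
  have humono : Monotone u := grid_monotone s t hst m
  have hb0 : ∀ j, 0 ≤ ∫ z in (u j : ℝ)..u (j + 1), b z := fun j =>
    integral_nonneg_of_pos h.posLeft (humono (Nat.le_succ j))
  have hv0 : ∀ j, 0 ≤ ∫ z in (u j : ℝ)..u (j + 1), v z := fun j =>
    integral_nonneg_of_pos h.posRight (humono (Nat.le_succ j))
  have hρ : ∀ j, (poissonMeasure (∫ x in (u j : ℝ)..u (j + 1), b x).toNNReal).withDensity
      (fun n => ENNReal.ofReal (gridWeight b v u j n)) =
      poissonMeasure ((∫ x in (u j : ℝ)..u (j + 1), b x).toNNReal +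
        (∫ x in (u j : ℝ)..u (j + 1), v x).toNNReal) := by
    intro j
    rw [← poissonMeasure_withDensity]
    · simp only [gridWeight, Real.coe_toNNReal _ (hb0 j), Real.coe_toNNReal _ (hv0 j)]
    -- Positivity of `b` leaves only cells of length zero, where both integrals vanish.
    · intro hr
      rw [Real.toNNReal_eq_zero] at hr
      rcases (Subtype.coe_le_coe.2 (humono (Nat.le_succ j))).lt_or_eq with hlt | heq
      · refine absurd hr (not_le.2 ?_)
        exact intervalIntegral.intervalIntegral_pos_of_pos_on
          (intervalIntegrable_of_continuousOn h.contLeft _ _)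
          (fun z hz => h.posLeft z ⟨(u j).2.1.trans hz.1.le, hz.2.le.trans (u (j + 1)).2.2⟩) hlt
      · simp only [Nat.succ_eq_add_one] at heq
        simp [heq]
  have key := hP.lintegral_prod_increments humono hρ (X := X) (by rwa [hu, grid_zero]) (m + 1) g
  have hsum : ∑ j ∈ Finset.range (m + 1), ((∫ x in (u j : ℝ)..u (j + 1), b x).toNNReal +
      (∫ x in (u j : ℝ)..u (j + 1), v x).toNNReal) =
      (∫ z in (s : ℝ)..t, (b z + v z)).toNNReal := by
    rw [intervalIntegral.integral_add (intervalIntegrable_of_continuousOn h.contLeft _ _)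
      (intervalIntegrable_of_continuousOn h.contRight _ _),
      Real.toNNReal_add (integral_nonneg_of_pos h.posLeft hst)
        (integral_nonneg_of_pos h.posRight hst),
      Finset.sum_add_distrib, ← Real.toNNReal_sum_of_nonneg (fun j _ => hb0 j),
      ← Real.toNNReal_sum_of_nonneg (fun j _ => hv0 j), sum_integral_grid h.contLeft,
      sum_integral_grid h.contRight]
  rw [hsum] at key
  rw [← key]
  refine lintegral_congr fun ω => ?_
  rw [gridRatio, ENNReal.ofReal_prod_of_nonneg fun j _ => gridWeight_nonneg h humono _ _]
  simp only [hu, grid_zero, grid_last]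

/-- The value `c = ∞` is allowed because the other factor tends to 1, not 0; `X` below need not be
integrable. -/
lemma tendsto_ofReal_one_add_pow_mul (n : ℕ) (c : ℝ≥0∞) :
    Tendsto (fun δ : ℝ => ENNReal.ofReal ((1 + δ) ^ n) * c) (𝓝[>] 0) (𝓝 c) := by
  have h1 : Tendsto (fun δ : ℝ => (1 + δ) ^ n) (𝓝[>] 0) (𝓝 1) := by
    have : ContinuousAt (fun δ : ℝ => (1 + δ) ^ n) 0 := by fun_prop
    simpa [ContinuousAt] using this.tendsto.mono_left nhdsWithin_le_nhds
  have h2 := ENNReal.Tendsto.mul_const (b := c) (ENNReal.tendsto_ofReal h1)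
    (Or.inl (by simp))
  simpa using h2

lemma IsPoissonProcess.lintegral_segmentRatio_eq (hP : IsPoissonProcess P ℱ N b)
    (h : IsRegularPair T b v) {s t : Set.Icc (0 : ℝ) T} (hst : s ≤ t)
    {X : Ω → ℝ≥0∞} (hX : Measurable[ℱ s] X) (n : ℕ) :
    ∫⁻ ω, X ω * ENNReal.ofReal (segmentRatio T (fun z => N z ω) b v s t) *
        ({n} : Set ℕ).indicator 1 (N t ω - N s ω) ∂P =
      (∫⁻ ω, X ω ∂P) * poissonMeasure (∫ z in (s : ℝ)..t, (b z + v z)).toNNReal {n} := by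
  have hgrid := fun m => hP.lintegral_gridRatio h hst hX m (({n} : Set ℕ).indicator 1)
  simp_rw [lintegral_indicator_one (measurableSet_singleton n)] at hgrid
  -- The indicator freezes the increment at `n`, turning the random factor `q ^ (N t - N s)` into
  -- the constant `q ^ n`.
  have hcompare : ∀ (q : ℝ), 0 ≤ q → ∀ Y Z : Ω → ℝ,
      (∀ ω, Y ω ≤ q ^ (N t ω - N s ω) * Z ω) →
      ∫⁻ ω, X ω * ENNReal.ofReal (Y ω) * ({n} : Set ℕ).indicator 1 (N t ω - N s ω) ∂P ≤
        ENNReal.ofReal (q ^ n) * ∫⁻ ω, X ω * ENNReal.ofReal (Z ω) *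
          ({n} : Set ℕ).indicator 1 (N t ω - N s ω) ∂P := by
    intro q hq Y Z hYZ
    rw [← lintegral_const_mul' _ _ ENNReal.ofReal_ne_top]
    refine lintegral_mono fun ω => ?_
    by_cases hn : N t ω - N s ω = n
    · simp only [hn, Set.mem_singleton_iff, Set.indicator_of_mem, Pi.one_apply, mul_one]
      have := ENNReal.ofReal_le_ofReal (hYZ ω)
      rw [hn, ENNReal.ofReal_mul (by positivity)] at this
      calc _ ≤ X ω * (ENNReal.ofReal (q ^ n) * ENNReal.ofReal (Z ω)) := by gcongr
        _ = _ := by ring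
    · simp [hn]
  refine le_antisymm ?_ ?_
  · refine ge_of_tendsto (tendsto_ofReal_one_add_pow_mul n _) ?_
    filter_upwards [self_mem_nhdsWithin] with δ hδ
    have hδ' : (0 : ℝ) < δ := hδ
    -- One fine partition suffices for each `δ`, since the grid integral does not depend on `m`.
    obtain ⟨m, hm⟩ := (eventually_gridRatio_le h hst hδ').exists
    rw [← hgrid m]
    exact hcompare (1 + δ) (by positivity) _ _ fun ω => (hm _ (hP.counting ω)).2
  · refine ge_of_tendsto (tendsto_ofReal_one_add_pow_mul n _) ?_
    filter_upwards [self_mem_nhdsWithin] with δ hδ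
    have hδ' : (0 : ℝ) < δ := hδ
    obtain ⟨m, hm⟩ := (eventually_gridRatio_le h hst hδ').exists
    rw [← hgrid m]
    exact hcompare (1 + δ) (by positivity) _ _ fun ω => (hm _ (hP.counting ω)).1

/-- Reweighted by `segmentRatio` over `(s, t]`, the increment over `(s, t]` is Poisson with the
intensity `b + v`, independently of the past of `s`. -/
lemma IsPoissonProcess.lintegral_segmentRatio (hP : IsPoissonProcess P ℱ N b)
    (h : IsRegularPair T b v) {s t : Set.Icc (0 : ℝ) T} (hst : s ≤ t)
    {X : Ω → ℝ≥0∞} (hX : Measurable[ℱ s] X) (g : ℕ → ℝ≥0∞) :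
    ∫⁻ ω, X ω * ENNReal.ofReal (segmentRatio T (fun z => N z ω) b v s t) *
        g (N t ω - N s ω) ∂P =
      (∫⁻ ω, X ω ∂P) * ∫⁻ n, g n ∂poissonMeasure (∫ z in (s : ℝ)..t, (b z + v z)).toNNReal := by
  have hXm : Measurable X := hX.mono (ℱ.le _) le_rfl
  have hS : Measurable fun ω => segmentRatio T (fun z => N z ω) b v s t :=
    (hP.measurable_segmentRatio h hst).mono (ℱ.le _) le_rfl
  have hD : Measurable fun ω => N t ω - N s ω := (hP.measurable t).sub (hP.measurable s)
  have hterm : ∀ n, Measurable fun ω =>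
      X ω * ENNReal.ofReal (segmentRatio T (fun z => N z ω) b v s t) *
        ({n} : Set ℕ).indicator 1 (N t ω - N s ω) := fun n =>
    (hXm.mul hS.ennreal_ofReal).mul
      ((measurable_from_top (f := ({n} : Set ℕ).indicator (1 : ℕ → ℝ≥0∞))).comp hD)
  have hsplit : ∀ ω, X ω * ENNReal.ofReal (segmentRatio T (fun z => N z ω) b v s t) *
      g (N t ω - N s ω) = ∑' n, g n *
        (X ω * ENNReal.ofReal (segmentRatio T (fun z => N z ω) b v s t) *
          ({n} : Set ℕ).indicator 1 (N t ω - N s ω)) := by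
    intro ω
    rw [tsum_eq_single (N t ω - N s ω)]
    · simp [mul_comm]
    · intro n hn
      simp [hn.symm]
  simp_rw [hsplit]
  rw [lintegral_tsum fun n => ((hterm n).const_mul _).aemeasurable, lintegral_countable' g,
    ← ENNReal.tsum_mul_left]
  refine tsum_congr fun n => ?_
  rw [lintegral_const_mul _ (hterm n), hP.lintegral_segmentRatio_eq h hst hX]
  ring

/-- Reweighted by `localRatio`, increments are Poisson with intensity `b + v`, independently of
the past. -/
lemma IsPoissonProcess.lintegral_localRatio (hT : 0 ≤ T) (hP : IsPoissonProcess P ℱ N b)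
    (h : IsRegularPair T b v) {s t : Set.Icc (0 : ℝ) T} (hst : s ≤ t)
    {X : Ω → ℝ≥0∞} (hX : Measurable[ℱ s] X) (g : ℕ → ℝ≥0∞) :
    ∫⁻ ω, X ω * ENNReal.ofReal (localRatio T (fun z => N z ω) b v) * g (N t ω - N s ω) ∂P =
      (∫⁻ ω, X ω * ENNReal.ofReal (localRatio T (fun z => N z ω) b v) ∂P) *
        ∫⁻ n, g n ∂poissonMeasure (∫ z in (s : ℝ)..t, (b z + v z)).toNNReal := by
  let o : Set.Icc (0 : ℝ) T := ⟨0, le_rfl, hT⟩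
  let e : Set.Icc (0 : ℝ) T := ⟨T, hT, le_rfl⟩
  have hos : o ≤ s := s.2.1
  have hte : t ≤ e := t.2.2
  set S : Set.Icc (0 : ℝ) T → Set.Icc (0 : ℝ) T → Ω → ℝ≥0∞ := fun p q ω =>
    ENNReal.ofReal (segmentRatio T (fun z => N z ω) b v p q) with hSdef
  have hSm : ∀ {p q}, p ≤ q → Measurable[ℱ q] (S p q) := fun hpq =>
    (hP.measurable_segmentRatio h hpq).ennreal_ofReal
  have hfac : ∀ ω, ENNReal.ofReal (localRatio T (fun z => N z ω) b v) =
      S o s ω * S s t ω * S t e ω := by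
    intro ω
    have hx := hP.counting ω
    rw [← segmentRatio_zero_eq_localRatio hx,
      ← segmentRatio_mul h.contRight hx (r := o) (s := t) (t := e) (hos.trans hst) hte,
      ← segmentRatio_mul h.contRight hx hos hst, ENNReal.ofReal_mul, ENNReal.ofReal_mul]
    · exact segmentRatio_nonneg h hx _ _
    · exact mul_nonneg (segmentRatio_nonneg h hx _ _) (segmentRatio_nonneg h hx _ _)
  have main : ∀ g : ℕ → ℝ≥0∞,
      ∫⁻ ω, X ω * ENNReal.ofReal (localRatio T (fun z => N z ω) b v) * g (N t ω - N s ω) ∂P =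
      (∫⁻ ω, X ω * S o s ω ∂P) *
        ∫⁻ n, g n ∂poissonMeasure (∫ z in (s : ℝ)..t, (b z + v z)).toNNReal := by
    intro g
    have hXS : Measurable[ℱ s] fun ω => X ω * S o s ω := hX.mul (hSm hos)
    have hY : Measurable[ℱ t] fun ω => X ω * S o s ω * S s t ω * g (N t ω - N s ω) :=
      ((hXS.mono (ℱ.mono hst) le_rfl).mul (hSm hst)).mul
        ((measurable_from_top (f := g)).comp (hP.measurable_sub hst le_rfl))
    rw [← hP.lintegral_segmentRatio h hst hXS g]
    -- The factor over `(t, T]` has mean 1 given the past of `t`, so it integrates out.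
    have h2 := hP.lintegral_segmentRatio h hte hY 1
    simp only [Pi.one_apply, mul_one, lintegral_one, measure_univ] at h2
    rw [← h2]
    refine lintegral_congr fun ω => ?_
    rw [hfac]
    simp only [hSdef]
    ring
  -- Taking `g = 1` identifies the constant: inserting the factors after `s` does not change the
  -- integral of `X` against the density.
  have h1 := main 1
  simp only [Pi.one_apply, mul_one, lintegral_one, measure_univ] at h1
  rw [main g, h1]

lemma IsPoissonProcess.lintegral_localRatio_eq_one [IsProbabilityMeasure P] (hT : 0 ≤ T)
    (hP : IsPoissonProcess P ℱ N b) (h : IsRegularPair T b v) :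
    ∫⁻ ω, ENNReal.ofReal (localRatio T (fun z => N z ω) b v) ∂P = 1 := by
  have := hP.lintegral_segmentRatio h (s := ⟨0, le_rfl, hT⟩) (t := ⟨T, hT, le_rfl⟩) hT
    (X := 1) measurable_const 1
  simp only [Pi.one_apply, mul_one, one_mul, lintegral_one, measure_univ] at this
  rw [← this]
  exact lintegral_congr fun ω => by rw [segmentRatio_zero_eq_localRatio (hP.counting ω)]

lemma IsPoissonProcess.measurable_localRatio (hT : 0 ≤ T)
    (hP : IsPoissonProcess P ℱ N b) (h : IsRegularPair T b v) :
    Measurable[ℱ ⟨T, hT, le_rfl⟩] fun ω => localRatio T (fun z => N z ω) b v := by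
  have := hP.measurable_segmentRatio h (s := ⟨0, le_rfl, hT⟩) (t := ⟨T, hT, le_rfl⟩) hT
  simpa only [segmentRatio_zero_eq_localRatio (hP.counting _)] using this

end

/-! ### Independence and product densities. -/

section

/-- The sets `A ∩ B` with `A` in `m₂` and `B` in `m₃` form a generating π-system, and on it the
probability factorises by splitting off `B` first. -/
lemma indep_sup_right {Ω : Type*} {m₁ m₂ m m₃ mΩ : MeasurableSpace Ω} {P : Measure Ω}
    [IsProbabilityMeasure P] (hm : m ≤ mΩ) (h₃ : m₃ ≤ mΩ) (h₁m : m₁ ≤ m) (h₂m : m₂ ≤ m)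
    (h₁₂ : Indep m₁ m₂ P) (hm₃ : Indep m m₃ P) : Indep m₁ (m₂ ⊔ m₃) P := by
  set p : Set (Set Ω) :=
    {C | ∃ A B, MeasurableSet[m₂] A ∧ MeasurableSet[m₃] B ∧ A ∩ B = C} with hp
  have hgen : m₂ ⊔ m₃ = MeasurableSpace.generateFrom p := by
    refine le_antisymm (sup_le ?_ ?_) (MeasurableSpace.generateFrom_le ?_)
    · exact fun A hA => MeasurableSpace.measurableSet_generateFrom
        ⟨A, Set.univ, hA, MeasurableSet.univ, Set.inter_univ A⟩
    · exact fun B hB => MeasurableSpace.measurableSet_generateFrom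
        ⟨Set.univ, B, MeasurableSet.univ, hB, Set.univ_inter B⟩
    · rintro _ ⟨A, B, hA, hB, rfl⟩
      exact MeasurableSet.inter ((le_sup_left : m₂ ≤ m₂ ⊔ m₃) A hA)
        ((le_sup_right : m₃ ≤ m₂ ⊔ m₃) B hB)
  refine IndepSets.indep (h₁m.trans hm) (sup_le (h₂m.trans hm) h₃)
    (@MeasurableSpace.isPiSystem_measurableSet _ m₁) ?_
    (@MeasurableSpace.generateFrom_measurableSet _ m₁).symm hgen ?_
  · rintro _ ⟨A, B, hA, hB, rfl⟩ _ ⟨A', B', hA', hB', rfl⟩ -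
    refine ⟨A ∩ A', B ∩ B', hA.inter hA', hB.inter hB', ?_⟩
    ext; simp; tauto
  · rw [IndepSets_iff]
    rintro C _ hC ⟨A, B, hA, hB, rfl⟩
    rw [Indep_iff] at h₁₂ hm₃
    rw [← Set.inter_assoc, hm₃ _ _ ((h₁m _ hC).inter (h₂m _ hA)) hB, h₁₂ _ _ hC hA,
      hm₃ _ _ (h₂m _ hA) hB, mul_assoc]

section Tilt

variable {Ω ι : Type*} [Fintype ι] {mΩ : MeasurableSpace Ω} {P : Measure Ω}
  {m : ι → MeasurableSpace Ω} {Z : ι → Ω → ℝ≥0∞}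

/-- Absorbing the indicator of `A i` into `Z i` keeps it `m i`-measurable, so the expectation of the
product factorises. -/
lemma withDensity_prod_iInter (hm : ∀ i, m i ≤ mΩ) (hind : iIndep m P)
    (hZ : ∀ i, Measurable[m i] (Z i)) {A : ι → Set Ω} (hA : ∀ i, MeasurableSet[m i] (A i)) :
    P.withDensity (fun ω => ∏ i, Z i ω) (⋂ i, A i) = ∏ i, ∫⁻ ω in A i, Z i ω ∂P := by
  have hAm : ∀ i, MeasurableSet (A i) := fun i => hm i _ (hA i)
  have hY : ∀ i, Measurable[m i] ((A i).indicator (Z i)) := fun i => (hZ i).indicator (hA i)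
  have hYind : iIndepFun (fun i => (A i).indicator (Z i)) P := by
    rw [iIndepFun_iff]
    rw [iIndep_iff] at hind
    exact fun s f hf => hind s fun i hi => (hY i).comap_le _ (hf i hi)
  rw [withDensity_apply _ (MeasurableSet.iInter hAm),
    ← lintegral_indicator (MeasurableSet.iInter hAm)]
  simp_rw [← fun i => lintegral_indicator (μ := P) (hAm i) (Z i)]
  rw [← lintegral_prod_eq_prod_lintegral_of_indepFun _ _ hYind fun i => (hY i).mono (hm i) le_rfl]
  refine lintegral_congr fun ω => ?_
  by_cases hω : ω ∈ ⋂ i, A i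
  · rw [Set.indicator_of_mem hω]
    exact Finset.prod_congr rfl fun i _ =>
      (Set.indicator_of_mem (Set.mem_iInter.1 hω i) _).symm
  · rw [Set.indicator_of_notMem hω]
    obtain ⟨i, hi⟩ := not_forall.1 (mt Set.mem_iInter.2 hω)
    exact (Finset.prod_eq_zero (Finset.mem_univ i) (Set.indicator_of_notMem hi _)).symm

/-- On events of one component the other densities integrate to 1, so only its own density is seen.
-/
lemma withDensity_prod_apply (hm : ∀ i, m i ≤ mΩ) (hind : iIndep m P)
    (hZ : ∀ i, Measurable[m i] (Z i)) (hZ1 : ∀ i, ∫⁻ ω, Z i ω ∂P = 1) {i : ι} {A : Set Ω}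
    (hA : MeasurableSet[m i] A) :
    P.withDensity (fun ω => ∏ i, Z i ω) A = ∫⁻ ω in A, Z i ω ∂P := by
  classical
  have key := withDensity_prod_iInter hm hind hZ
    (A := Function.update (fun _ => Set.univ) i A) (fun j => by
      rcases eq_or_ne j i with rfl | hj
      · simpa using hA
      · simp [hj])
  rw [Finset.prod_eq_single i] at key
  · rw [Function.update_self] at key
    rw [← key]
    congr 1
    ext ω
    simp only [Set.mem_iInter]
    refine ⟨fun hω j => ?_, fun hω => by simpa using hω i⟩
    rcases eq_or_ne j i with rfl | hj
    · simpa using hω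
    · simp [hj]
  · intro j _ hj
    simp [hj, hZ1]
  · simp

lemma isProbabilityMeasure_withDensity_prod (hm : ∀ i, m i ≤ mΩ) (hind : iIndep m P)
    (hZ : ∀ i, Measurable[m i] (Z i)) (hZ1 : ∀ i, ∫⁻ ω, Z i ω ∂P = 1) :
    IsProbabilityMeasure (P.withDensity fun ω => ∏ i, Z i ω) := by
  have key := withDensity_prod_iInter hm hind hZ (A := fun _ => Set.univ)
    fun i => MeasurableSet.univ
  simp only [Set.iInter_univ, Measure.restrict_univ, hZ1, Finset.prod_const_one] at key
  exact ⟨key⟩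

lemma iIndep_withDensity_prod (hm : ∀ i, m i ≤ mΩ) (hind : iIndep m P)
    (hZ : ∀ i, Measurable[m i] (Z i)) (hZ1 : ∀ i, ∫⁻ ω, Z i ω ∂P = 1) :
    iIndep m (P.withDensity fun ω => ∏ i, Z i ω) := by
  classical
  rw [iIndep_iff]
  intro s f hf
  have key := withDensity_prod_iInter hm hind hZ
    (A := fun i => if i ∈ s then f i else Set.univ) (fun i => by
      by_cases hi : i ∈ s
      · simpa [hi] using hf i hi
      · simp [hi])
  have hset : (⋂ i, if i ∈ s then f i else Set.univ) = ⋂ i ∈ s, f i := by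
    ext ω
    simp only [Set.mem_iInter]
    refine forall_congr' fun i => ?_
    by_cases hi : i ∈ s <;> simp [hi]
  rw [hset] at key
  rw [key, ← Finset.prod_subset (Finset.subset_univ s)]
  · refine Finset.prod_congr rfl fun i hi => ?_
    rw [withDensity_prod_apply hm hind hZ hZ1 (hf i hi), if_pos hi]
  · intro i _ hi
    simp [hi, hZ1]

end Tilt

end

/-! ### Own past, joint past and whole paths. -/

section

/-- The σ-algebra generated by a whole path over `[0, T]`. -/
abbrev pathSigma {Ω : Type*} (T : ℝ) (N : ℝ → Ω → ℕ) : MeasurableSpace Ω :=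
  MeasurableSpace.comap (fun ω (t : Set.Icc (0 : ℝ) T) => N t ω) MeasurableSpace.pi

variable {Ω : Type*} [mΩ : MeasurableSpace Ω] {T : ℝ}

/-- The filtration generated by a single counting process. -/
noncomputable def ownHistory (N : ℝ → Ω → ℕ)
    (hN : ∀ t : Set.Icc (0 : ℝ) T, Measurable (N t)) : Filtration (Set.Icc (0 : ℝ) T) mΩ :=
  Filtration.natural (fun (t : Set.Icc (0 : ℝ) T) ω => N t ω) fun t => (hN t).stronglyMeasurable

lemma comap_le_pathSigma {Ω : Type*} (N : ℝ → Ω → ℕ) (t : Set.Icc (0 : ℝ) T) :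
    MeasurableSpace.comap (N t) inferInstance ≤ pathSigma T N := by
  rw [← measurable_iff_comap_le]
  exact (measurable_pi_apply t).comp (comap_measurable fun ω (t : Set.Icc (0 : ℝ) T) => N t ω)

lemma pathSigma_le {N : ℝ → Ω → ℕ} (hN : ∀ t : Set.Icc (0 : ℝ) T, Measurable (N t)) :
    pathSigma T N ≤ mΩ :=
  measurable_iff_comap_le.1 (measurable_pi_lambda _ hN)

lemma ownHistory_le_pathSigma {N : ℝ → Ω → ℕ}
    (hN : ∀ t : Set.Icc (0 : ℝ) T, Measurable (N t)) (s : Set.Icc (0 : ℝ) T) :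
    ownHistory N hN s ≤ pathSigma T N :=
  iSup₂_le fun u _ => comap_le_pathSigma N u

variable {k : ℕ} {N : Fin k → ℝ → Ω → ℕ}
  {hN : ∀ i, ∀ t : Set.Icc (0 : ℝ) T, Measurable (N i t)}

lemma adapted_history (i : Fin k) (t : Set.Icc (0 : ℝ) T) : Measurable[history N hN t] (N i t) := by
  have h : Measurable[history N hN t] fun ω (i : Fin k) => N i t ω :=
    measurable_iff_comap_le.2
      (le_iSup₂_of_le (f := fun (u : Set.Icc (0 : ℝ) T) (_ : u ≤ t) =>
        MeasurableSpace.comap (fun ω (i : Fin k) => N i u ω) MeasurableSpace.pi) t le_rfl le_rfl)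
  exact (measurable_pi_apply i).comp h

lemma ownHistory_le_history (i : Fin k) (s : Set.Icc (0 : ℝ) T) :
    ownHistory (N i) (hN i) s ≤ history N hN s :=
  iSup₂_le fun u hu => measurable_iff_comap_le.1
    ((adapted_history i u).mono ((history N hN).mono hu) le_rfl)

lemma history_le_sup (i : Fin k) (s : Set.Icc (0 : ℝ) T) :
    history N hN s ≤
      ownHistory (N i) (hN i) s ⊔ ⨆ j ∈ ({i}ᶜ : Set (Fin k)), pathSigma T (N j) := by
  refine iSup₂_le fun u hu => ?_
  have hpi := MeasurableSpace.comap_process_pi (fun (j : Fin k) ω => N j u ω)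
  refine hpi.le.trans (iSup_le fun j => ?_)
  rcases eq_or_ne j i with rfl | hj
  · refine le_sup_of_le_left ?_
    exact le_iSup₂_of_le (f := fun (u : Set.Icc (0 : ℝ) T) (_ : u ≤ s) =>
        MeasurableSpace.comap (N j u) inferInstance) u hu le_rfl
  · exact le_sup_of_le_right (le_iSup₂_of_le j hj (comap_le_pathSigma (N j) u))

/-- In the own filtration the local density and the past are functions of one path, so the other
components drop out of the computation. -/
lemma IsPoissonProcess.ownHistory {P : Measure Ω} {i : Fin k} {b : ℝ → ℝ}
    (h : IsPoissonProcess P (history N hN) (N i) b) :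
    IsPoissonProcess P (ownHistory (N i) (hN i)) (N i) b where
  intensity_nonneg := h.intensity_nonneg
  intensity_measurable := h.intensity_measurable
  intensity_integrable := h.intensity_integrable
  counting := h.counting
  adapted t := measurable_iff_comap_le.2
    (le_iSup₂_of_le (f := fun (u : Set.Icc (0 : ℝ) T) (_ : u ≤ t) =>
        MeasurableSpace.comap (N i u) inferInstance) t le_rfl le_rfl)
  indep s t hst := indep_of_indep_of_le_right (h.indep s t hst) (ownHistory_le_history i s)
  law := h.law

lemma IsAdmissible.isRegularPair {β ν : Fin k → ℝ → ℝ} (hβ : IsAdmissible T β)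
    (hν : IsAdmissible T ν) (i : Fin k) : IsRegularPair T (β i) (ν i) := by
  obtain ⟨m, M, hm, -, hβ⟩ := hβ
  obtain ⟨m', M', hm', -, hν⟩ := hν
  exact ⟨(hβ i).1, (hν i).1, fun z hz => hm.trans_le ((hβ i).2 hz).1,
    fun z hz => hm'.trans_le ((hν i).2 hz).1⟩

lemma localRatio_nonneg (hT : 0 ≤ T) {b v : ℝ → ℝ} (h : IsRegularPair T b v) {x : ℝ → ℕ}
    (hx : IsCountingPath T x) : 0 ≤ localRatio T x b v := by
  rw [← segmentRatio_zero_eq_localRatio hx]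
  exact segmentRatio_nonneg h hx ⟨0, le_rfl, hT⟩ ⟨T, hT, le_rfl⟩

end

end PoissonDetection

/-! ### Assembly of the change of measure. -/

open PoissonDetection in
theorem mainTheorem2 {Ω : Type*} [MeasurableSpace Ω] (P₀ : MeasureTheory.Measure Ω)
    [MeasureTheory.IsProbabilityMeasure P₀] (k : ℕ) (T : ℝ) (hT : 0 < T)
    (N : Fin k → ℝ → Ω → ℕ) (hN : ∀ i, ∀ t : Set.Icc (0 : ℝ) T, Measurable (N i t))
    (β ν : Fin k → ℝ → ℝ)
    (hβ : PoissonDetection.IsAdmissible T β) (hν : PoissonDetection.IsAdmissible T ν)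
    (hPoisson : PoissonDetection.AreIndepPoisson P₀ N hN β) :
    Measurable (PoissonDetection.likelihoodRatio T N β ν) ∧
    MeasureTheory.IsProbabilityMeasure (PoissonDetection.tilted P₀ T N β ν) ∧
    (PoissonDetection.tilted P₀ T N β ν).AbsolutelyContinuous P₀ ∧
    PoissonDetection.AreIndepPoisson (PoissonDetection.tilted P₀ T N β ν) N hN
      (fun i t => β i t + ν i t) := by
  have hreg := hβ.isRegularPair hν
  have hown := fun i => (hPoisson.poisson i).ownHistory
  have hcount : ∀ i ω, IsCountingPath T fun t => N i t ω := fun i => (hPoisson.poisson i).counting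
  have hpath : ∀ i, pathSigma T (N i) ≤ _ := fun i => pathSigma_le (hN i)
  have hLm : ∀ i, Measurable[pathSigma T (N i)] fun ω =>
      localRatio T (fun t => N i t ω) (β i) (ν i) := fun i =>
    ((hown i).measurable_localRatio hT.le (hreg i)).mono (ownHistory_le_pathSigma _ _) le_rfl
  set Z : Fin k → Ω → ENNReal := fun i ω =>
    ENNReal.ofReal (localRatio T (fun t => N i t ω) (β i) (ν i)) with hZdef
  have hZm : ∀ i, Measurable[pathSigma T (N i)] (Z i) := fun i => (hLm i).ennreal_ofReal
  have hZ1 : ∀ i, ∫⁻ ω, Z i ω ∂P₀ = 1 := fun i =>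
    (hown i).lintegral_localRatio_eq_one hT.le (hreg i)
  have htilt : tilted P₀ T N β ν = P₀.withDensity fun ω => ∏ i, Z i ω := by
    refine congrArg P₀.withDensity (funext fun ω => ?_)
    exact ENNReal.ofReal_prod_of_nonneg fun i _ => localRatio_nonneg hT.le (hreg i) (hcount i ω)
  have hind : iIndep (fun i => pathSigma T (N i)) P₀ := hPoisson.indep
  have hprob := isProbabilityMeasure_withDensity_prod hpath hind hZm hZ1
  have hindQ := iIndep_withDensity_prod hpath hind hZm hZ1
  have happly := fun i A hA => withDensity_prod_apply hpath hind hZm hZ1 (i := i) (A := A) hA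
  rw [htilt]
  set Q := P₀.withDensity fun ω => ∏ i, Z i ω
  have hD : ∀ i, ∀ s t : Set.Icc (0 : ℝ) T, Measurable fun ω => N i t ω - N i s ω :=
    fun i s t => (hN i t).sub (hN i s)
  have hDpath : ∀ i, ∀ s t : Set.Icc (0 : ℝ) T,
      Measurable[pathSigma T (N i)] fun ω => N i t ω - N i s ω := fun i s t =>
    Measurable.sub (measurable_iff_comap_le.2 (comap_le_pathSigma _ _))
      (measurable_iff_comap_le.2 (comap_le_pathSigma _ _))
  -- Both events belong to the path of component `i`, so `Q` may be computed with the density `Z i`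
  -- alone; the single-component formula then applies with indicators as test functions.
  have hjoint : ∀ i, ∀ s t : Set.Icc (0 : ℝ) T, s ≤ t → ∀ A,
      MeasurableSet[ownHistory (N i) (hN i) s] A → ∀ S : Set ℕ,
      Q (A ∩ (fun ω => N i t ω - N i s ω) ⁻¹' S) =
        Q A * poissonMeasure (∫ z in (s : ℝ)..t, (β i z + ν i z)).toNNReal S := by
    intro i s t hst A hA S
    have hA' := ownHistory_le_pathSigma (hN i) s A hA
    have hS' : MeasurableSet[pathSigma T (N i)] ((fun ω => N i t ω - N i s ω) ⁻¹' S) :=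
      hDpath i s t (MeasurableSet.of_discrete (s := S))
    rw [happly i _ (hA'.inter hS'), happly i _ hA',
      ← lintegral_indicator (hpath i _ (hA'.inter hS')), ← lintegral_indicator (hpath i _ hA')]
    have key := (hown i).lintegral_localRatio hT.le (hreg i) hst
      (X := A.indicator fun _ => 1) (measurable_const.indicator hA) (S.indicator 1)
    rw [lintegral_indicator_one MeasurableSet.of_discrete] at key
    convert key using 1
    · refine lintegral_congr fun ω => ?_
      by_cases h1 : ω ∈ A <;> by_cases h2 : N i t ω - N i s ω ∈ S <;> simp [h1, h2, hZdef]
    · congr 1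
      refine lintegral_congr fun ω => ?_
      by_cases h1 : ω ∈ A <;> simp [h1, hZdef]
  have hlaw : ∀ i, ∀ s t : Set.Icc (0 : ℝ) T, s ≤ t → ∀ S : Set ℕ,
      Q ((fun ω => N i t ω - N i s ω) ⁻¹' S) =
        poissonMeasure (∫ z in (s : ℝ)..t, (β i z + ν i z)).toNNReal S := by
    intro i s t hst S
    have := hjoint i s t hst Set.univ MeasurableSet.univ S
    rwa [Set.univ_inter, measure_univ, one_mul] at this
  refine ⟨?_, hprob, withDensity_absolutelyContinuous _ _, ?_, hindQ⟩
  · exact Finset.measurable_fun_prod _ fun i _ => (hLm i).mono (hpath i) le_rfl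
  · intro i
    have hcont : ContinuousOn (fun t => β i t + ν i t) (Set.Icc 0 T) :=
      (hreg i).contLeft.add (hreg i).contRight
    refine ⟨fun t ht => (add_pos ((hreg i).posLeft t ht) ((hreg i).posRight t ht)).le,
      (continuousOn_iff_continuous_domRestrict.1 hcont).measurable, hcont.integrableOn_Icc,
      hcount i, adapted_history i, fun s t hst => ?_, fun s t hst => ⟨(hD i s t).aemeasurable, ?_⟩⟩
    · have hsingle : Indep (MeasurableSpace.comap (fun ω => N i t ω - N i s ω) ⊤)
          (ownHistory (N i) (hN i) s) Q := by
        rw [Indep_iff]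
        rintro _ A ⟨S, -, rfl⟩ hA
        rw [Set.inter_comm, hjoint i s t hst A hA S, hlaw i s t hst S, mul_comm]
      -- Independence of the whole paths under `Q` supplies the other half: the remaining components
      -- are independent of the increment and the own past jointly.
      have hother : Indep (pathSigma T (N i))
          (⨆ j ∈ ({i}ᶜ : Set (Fin k)), pathSigma T (N j)) Q := by
        have := indep_iSup_of_disjoint hpath hindQ (S := {i}) (T := {i}ᶜ) disjoint_compl_right
        simpa only [Set.mem_singleton_iff, iSup_iSup_eq_left] using this
      exact indep_of_indep_of_le_right
        (indep_sup_right (hpath i) (iSup₂_le fun j _ => hpath j)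
          (measurable_iff_comap_le.1 (hDpath i s t)) (ownHistory_le_pathSigma _ _) hsingle hother)
        (history_le_sup i s)
    · ext S hS
      rw [Measure.map_apply (hD i s t) hS, hlaw i s t hst S]
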